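/- Identify $\mathbb C\otimes_{\mathbb R}\mathbb H$ with $\mathbb C^4$ through the basis $1,i,j,k$ and let $\sigma_k:\mathbb C^4\to\mathbb C^4$ be the $k$-th power map of this algebra. For $z=(z_0,z_1,z_2,z_3)$ put $\underline z^2=z_1^2+z_2^2+z_3^2$, and let $$\Omega=\{z\in\mathbb C^4:\ \underline z^2\neq0,\ z_0^2+\underline z^2\neq0,\ z_0\neq0\}.$$ Let $\mathcal S=\{s\in\mathbb C^4: s_0=0,\ \underline s^2=1\}$, let $\rho:\mathbb C^2\times\mathcal S\to\mathbb C^4$ be $\rho((u_0,u_1),s)=u_0e_0+u_1s$, and let $\mathfrak s_k$ be the map $$\mathfrak s_k((u_0,u_1),s)=\big((p_0^k(u_0,u_1^2),\,u_1p_1^{k-1}(u_0,u_1^2)),\,s\big),$$ where the polynomials $p_0^k,p_1^{k-1}$ are defined by $(x+\imath y)^k=p_0^k(x,y^2)+\imath y\,p_1^{k-1}(x,y^2)$ (so that $\rho\circ\mathfrak s_k=\sigma_k\circ\rho$). Put $W=\rho^{-1}(\Omega)$ and $W_k=\mathfrak s_k^{-1}(W)$. For $\eta\in\mathbb C$ let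 $A_\eta$ act on $\mathbb C^2\times\mathcal S$ by $$A_\eta((u_0,u_1),s)=\big((\operatorname{Re}\eta\,u_0-\operatorname{Im}\eta\,u_1,\ \operatorname{Im}\eta\,u_0+\operatorname{Re}\eta\,u_1),\,s\big).$$ **Theorem.** Let $k\ge1$ be odd. Let $U\subseteq\mathbb C$ be a non-empty open set, symmetric with respect to complex conjugation, each connected component of which is simply connected ($U$ may be disconnected and need not contain real points). For $G:U\to\mathbb C^4$ let $TG(z)=\overline{G(\bar z)}$. Let $F:U\to\mathbb C^4$ be a continuous stem function, i.e. $TF=F$, with $F(U)\subseteq\Omega$. By a lift of $F$ we mean a continuous $G:U\to\mathbb C^4$ with $\sigma_k\circ G=F$. Then: 1. For each $\eta$ with $\eta^k=1$, $A_\eta$ restricts to a homeomorphism of $W_k$ with $\mathfrak s_k\circ A_\eta=\mathfrak s_k$ (a deck transformation of $\mathfrak s_k:W_k\to W$). 2. There is a lift $G$ of $F$ with $TG=G$. For each such $G$ there is a continuous $H:U\to\mathbb C^2\times\mathcal S$ with $\rho\circ H=G$ such that the functions $\rho\circ A_\eta\circ H$, $\eta^k=1$, are $k$ distinct lifts of $F$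 fixed by $T$. In particular, at least $k$ lifts of $F$ are stem functions. 3. If moreover $U$ is connected, then $F$ has exactly $k^2$ lifts, exactly $k$ of which are fixed by $T$. For each lift $G$ with $TG=G$, there is a continuous $H$ with $\rho\circ H=G$, and for every such $H$ the map $\eta\mapsto\rho\circ A_\eta\circ H$ is a bijection from the $k$-th roots of unity onto the set of lifts fixed by $T$. -/

import Mathlib

open scoped Quaternion ComplexConjugate

noncomputable section

namespace SliceRoots

/-- Complex affine four-space, with coordinates `(z₀, z₁, z₂, z₃)` and its usual topology. -/
abbrev C4 : Type := Fin 4 → ℂ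

/-- The algebra `ℂ ⊗ ℍ`, as Hamilton's quaternions with complex coefficients
(`ℍ[R,-1,-1]` is what `ℍ[R]` unfolds to). -/
abbrev CH : Type := ℍ[ℂ,-1,-1]

/-- The element `v + √-1 w` of `ℂ ⊗ ℍ`, for `v, w ∈ ℍ`. -/
def complexify (v w : ℍ[ℝ,-1,-1]) : CH :=
  ⟨v.re + Complex.I * w.re, v.imI + Complex.I * w.imI,
    v.imJ + Complex.I * w.imJ, v.imK + Complex.I * w.imK⟩

/-- The product of `CH` is the product
`(v₀ + √-1 v₁)(w₀ + √-1 w₁) = (v₀w₀ - v₁w₁) + √-1 (v₀w₁ + v₁w₀)` of `ℂ ⊗ ℍ`. -/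
theorem complexify_mul (v₀ v₁ w₀ w₁ : ℍ[ℝ,-1,-1]) :
    complexify v₀ v₁ * complexify w₀ w₁ =
      complexify (v₀ * w₀ - v₁ * w₁) (v₀ * w₁ + v₁ * w₀) := by
  ext <;> simp [complexify] <;> ring_nf <;> simp only [Complex.I_sq] <;> ring

/-- The identification of `ℂ⁴` with `ℂ ⊗ ℍ` through the basis `1, i, j, k`. -/
def toCH (z : C4) : CH := ⟨z 0, z 1, z 2, z 3⟩

/-- The inverse identification of `ℂ ⊗ ℍ` with `ℂ⁴`. -/
def ofCH (q : CH) : C4 := ![q.re, q.imI, q.imJ, q.imK]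

/-- `σ_k`, the `k`-th power map of `ℂ ⊗ ℍ`, read on `ℂ⁴`. -/
def sigma (k : ℕ) (z : C4) : C4 := ofCH (toCH z ^ k)

/-- The complex number `z₁² + z₂² + z₃²`. -/
def vecSq (z : C4) : ℂ := z 1 ^ 2 + z 2 ^ 2 + z 3 ^ 2

/-- The open set `Ω` of `ℂ⁴`. -/
def Omega : Set C4 := {z | vecSq z ≠ 0 ∧ z 0 ^ 2 + vecSq z ≠ 0 ∧ z 0 ≠ 0}

/-- `TG(z) = conj (G (conj z))`, for functions on a set `U` that is symmetric about `ℝ`. -/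
def T {U : Set ℂ} (hU : ∀ z ∈ U, conj z ∈ U) (G : U → C4) : U → C4 :=
  fun z i => conj (G ⟨conj (z : ℂ), hU z z.2⟩ i)

/-- The (continuous) lifts of `F` through `σ_k`. -/
def lifts (k : ℕ) {U : Set ℂ} (F : U → C4) : Set (U → C4) :=
  {G | Continuous G ∧ ∀ z, sigma k (G z) = F z}

/-- The lifts of `F` through `σ_k` that are fixed by `T`, i.e. that are stem functions. -/
def stemLifts (k : ℕ) {U : Set ℂ} (hU : ∀ z ∈ U, conj z ∈ U) (F : U → C4) : Set (U → C4) :=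
  {G | G ∈ lifts k F ∧ T hU G = G}

/-- The imaginary units `(0, s₁, s₂, s₃)`, `s₁² + s₂² + s₃² = 1`, of `ℂ ⊗ ℍ`. -/
abbrev ImUnit : Type := {s : C4 // s 0 = 0 ∧ vecSq s = 1}

/-- `ρ((u₀, u₁), s) = u₀ e₀ + u₁ s`. -/
def rho (w : (ℂ × ℂ) × ImUnit) : C4 :=
  w.1.1 • (Pi.single 0 1 : C4) + w.1.2 • (w.2 : C4)

/-- The pair `(p_0^k(x, y), p_1^{k-1}(x, y))`; see `p_spec`. -/
def p : ℕ → ℂ → ℂ → ℂ × ℂ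
  | 0, _, _ => (1, 0)
  | k + 1, x, y => (x * (p k x y).1 - y * (p k x y).2, (p k x y).1 + x * (p k x y).2)

/-- `(x + ι y)^k = p_0^k(x, y²) + ι y p_1^{k-1}(x, y²)` whenever `ι² = -1`. -/
theorem p_spec (ι : ℂ) (hι : ι ^ 2 = -1) (k : ℕ) (x y : ℂ) :
    (x + ι * y) ^ k = (p k x (y ^ 2)).1 + ι * y * (p k x (y ^ 2)).2 := by
  induction k with
  | zero => simp [p]
  | succ k ih =>
    rw [pow_succ, ih]
    simp only [p]
    linear_combination (y ^ 2 * (p k x (y ^ 2)).2) * hι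

/-- The map `𝔰_k` on `ℂ² × 𝒮`, satisfying `ρ ∘ 𝔰_k = σ_k ∘ ρ`. -/
def frakS (k : ℕ) (w : (ℂ × ℂ) × ImUnit) : (ℂ × ℂ) × ImUnit :=
  (((p k w.1.1 (w.1.2 ^ 2)).1, w.1.2 * (p k w.1.1 (w.1.2 ^ 2)).2), w.2)

/-- The base `W = ρ⁻¹(Ω)` of the covering `𝔰_k`. -/
def W : Set ((ℂ × ℂ) × ImUnit) := rho ⁻¹' Omega

/-- The total space `W_k = 𝔰_k⁻¹(W)` of the covering `𝔰_k : W_k → W`. -/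
def WK (k : ℕ) : Set ((ℂ × ℂ) × ImUnit) := frakS k ⁻¹' W

/-- `(u, s) ↦ (A_η u, s)`, where `A_η` is the real matrix with rows
`(Re η, -Im η)` and `(Im η, Re η)`. -/
def A (η : ℂ) (w : (ℂ × ℂ) × ImUnit) : (ℂ × ℂ) × ImUnit :=
  (((η.re : ℂ) * w.1.1 - (η.im : ℂ) * w.1.2, (η.im : ℂ) * w.1.1 + (η.re : ℂ) * w.1.2), w.2)

/-- The complex `k`-th roots of unity. -/
def rootsU (k : ℕ) : Set ℂ := {η | η ^ k = 1}

end SliceRoots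

end

open scoped Quaternion ComplexConjugate

noncomputable section

namespace SliceRoots

/-! ### Coordinates adapted to an imaginary unit -/

/-! For an imaginary unit `s`, the plane `ℂ e₀ + ℂ s` is an algebra isomorphic to `ℂ × ℂ` through
its two orthogonal idempotents. In the coordinates `(a, b)` of `frame`, `σ_k` is `(a ^ k, b ^ k)`
(`sigma_frame`), `A_η` is `(η a, conj η b)` (`rho_A`), and conjugation swaps the factors
(`conj_frame`). A symmetric square root of `vecSq ∘ F` gives a continuous symmetric `s` with `F =
frame s c d`, where `c` and `d` do not vanish and `c ≠ d` on `Ω`. A root of `F` stays in the plane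
of `s` (`exists_frame_of_sigma_eq`), so a lift is a pair of continuous `k`-th roots of `c` and `d`:
on connected `U` this leaves `k * k` choices. Being fixed by `T` means that the second root is the
reflection of the first, so a change of roots by `(η, ζ)` keeps this exactly when `ζ = conj η`:
these are the `k` maps `A_η`. -/

/-- The element of the plane `ℂ e₀ + ℂ s` with coordinates `(a, b)` in the basis of idempotents
`(e₀ ∓ √-1 s) / 2`. -/
def frame (s : ImUnit) (a b : ℂ) : C4 :=
  rho (((a + b) / 2, (a - b) / (2 * Complex.I)), s)

theorem rho_zero (u : ℂ × ℂ) (s : ImUnit) : rho (u, s) 0 = u.1 := by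
  simp [rho, s.2.1]

theorem rho_of_ne_zero (u : ℂ × ℂ) (s : ImUnit) {i : Fin 4} (hi : i ≠ 0) :
    rho (u, s) i = u.2 * s.1 i := by
  simp [rho, hi]

theorem frame_zero (s : ImUnit) (a b : ℂ) : frame s a b 0 = (a + b) / 2 :=
  rho_zero _ s

theorem frame_of_ne_zero (s : ImUnit) (a b : ℂ) {i : Fin 4} (hi : i ≠ 0) :
    frame s a b i = (a - b) / (2 * Complex.I) * s.1 i :=
  rho_of_ne_zero _ s hi

theorem sq_sum_imUnit (s : ImUnit) : s.1 1 ^ 2 + s.1 2 ^ 2 + s.1 3 ^ 2 = 1 := s.2.2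

/-- The coefficient of `z` along the imaginary unit `s`. -/
def dot (s : ImUnit) (z : C4) : ℂ := z 1 * s.1 1 + z 2 * s.1 2 + z 3 * s.1 3

theorem dot_rho (u : ℂ × ℂ) (s : ImUnit) : dot s (rho (u, s)) = u.2 := by
  have h := sq_sum_imUnit s
  simp only [dot, rho_of_ne_zero _ _ (show (1 : Fin 4) ≠ 0 by decide),
    rho_of_ne_zero _ _ (show (2 : Fin 4) ≠ 0 by decide),
    rho_of_ne_zero _ _ (show (3 : Fin 4) ≠ 0 by decide)]
  linear_combination u.2 * h

theorem vecSq_rho (u : ℂ × ℂ) (s : ImUnit) : vecSq (rho (u, s)) = u.2 ^ 2 := by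
  have h := sq_sum_imUnit s
  simp only [vecSq, rho_of_ne_zero _ _ (show (1 : Fin 4) ≠ 0 by decide),
    rho_of_ne_zero _ _ (show (2 : Fin 4) ≠ 0 by decide),
    rho_of_ne_zero _ _ (show (3 : Fin 4) ≠ 0 by decide)]
  linear_combination u.2 ^ 2 * h

theorem rho_eq_frame (u : ℂ × ℂ) (s : ImUnit) :
    rho (u, s) = frame s (u.1 + Complex.I * u.2) (u.1 - Complex.I * u.2) := by
  have h : ((u.1 + Complex.I * u.2 + (u.1 - Complex.I * u.2)) / 2,
      (u.1 + Complex.I * u.2 - (u.1 - Complex.I * u.2)) / (2 * Complex.I)) = u := by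
    ext
    · ring
    · field_simp
      ring
  rw [frame, h]

theorem frame_fst (s : ImUnit) (a b : ℂ) :
    frame s a b 0 + Complex.I * dot s (frame s a b) = a := by
  rw [frame, rho_zero, dot_rho]
  field_simp
  ring

theorem frame_snd (s : ImUnit) (a b : ℂ) :
    frame s a b 0 - Complex.I * dot s (frame s a b) = b := by
  rw [frame, rho_zero, dot_rho]
  field_simp
  ring

theorem frame_inj {s : ImUnit} {a b a' b' : ℂ} :
    frame s a b = frame s a' b' ↔ a = a' ∧ b = b' := by
  refine ⟨fun h => ⟨?_, ?_⟩, by rintro ⟨rfl, rfl⟩; rfl⟩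
  · rw [← frame_fst s a b, h, frame_fst]
  · rw [← frame_snd s a b, h, frame_snd]

/-- Both vector parts are multiples of `s`, so the cross product vanishes, and `s ^ 2 = -1`; hence
the idempotents are orthogonal. -/
theorem toCH_frame_mul (s : ImUnit) (a b a' b' : ℂ) :
    toCH (frame s a b) * toCH (frame s a' b') = toCH (frame s (a * a') (b * b')) := by
  have h := sq_sum_imUnit s
  have h1 : (1 : Fin 4) ≠ 0 := by decide
  have h2 : (2 : Fin 4) ≠ 0 := by decide
  have h3 : (3 : Fin 4) ≠ 0 := by decide
  have hI : (2 * Complex.I) ^ 2 = -4 := by rw [mul_pow, Complex.I_sq]; norm_num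
  have hI0 : 2 * Complex.I ≠ 0 := by simp
  have hprod (x y : ℂ) : x / (2 * Complex.I) * (y / (2 * Complex.I)) = -(x * y) / 4 := by
    rw [div_mul_div_comm, ← pow_two, hI]; ring
  ext
  · simp only [toCH, QuaternionAlgebra.re_mul, frame_zero, frame_of_ne_zero _ _ _ h1,
      frame_of_ne_zero _ _ _ h2, frame_of_ne_zero _ _ _ h3]
    linear_combination -(s.1 1 ^ 2 + s.1 2 ^ 2 + s.1 3 ^ 2) * hprod (a - b) (a' - b') +
      (a - b) * (a' - b') / 4 * h
  · simp only [toCH, QuaternionAlgebra.imI_mul, frame_zero, frame_of_ne_zero _ _ _ h1,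
      frame_of_ne_zero _ _ _ h2, frame_of_ne_zero _ _ _ h3]
    ring
  · simp only [toCH, QuaternionAlgebra.imJ_mul, frame_zero, frame_of_ne_zero _ _ _ h1,
      frame_of_ne_zero _ _ _ h2, frame_of_ne_zero _ _ _ h3]
    ring
  · simp only [toCH, QuaternionAlgebra.imK_mul, frame_zero, frame_of_ne_zero _ _ _ h1,
      frame_of_ne_zero _ _ _ h2, frame_of_ne_zero _ _ _ h3]
    ring

theorem toCH_frame_one (s : ImUnit) : toCH (frame s 1 1) = 1 := by
  ext <;> simp [toCH, frame_zero, frame_of_ne_zero]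

theorem toCH_frame_pow (s : ImUnit) (a b : ℂ) (k : ℕ) :
    toCH (frame s a b) ^ k = toCH (frame s (a ^ k) (b ^ k)) := by
  induction k with
  | zero => simp [toCH_frame_one]
  | succ k ih => rw [pow_succ, ih, toCH_frame_mul, pow_succ, pow_succ]

theorem ofCH_toCH (z : C4) : ofCH (toCH z) = z := by
  ext i
  fin_cases i <;> rfl

theorem sigma_frame (k : ℕ) (s : ImUnit) (a b : ℂ) :
    sigma k (frame s a b) = frame s (a ^ k) (b ^ k) := by
  rw [sigma, toCH_frame_pow, ofCH_toCH]

/-- The imaginary part of a power of `z` is a multiple of the imaginary part of `z`. -/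
theorem exists_sigma_eq_mul (k : ℕ) (z : C4) : ∃ d : ℂ, ∀ i ≠ 0, sigma k z i = d * z i := by
  have key : ∃ d : ℂ, (toCH z ^ k).imI = d * z 1 ∧ (toCH z ^ k).imJ = d * z 2 ∧
      (toCH z ^ k).imK = d * z 3 := by
    induction k with
    | zero => exact ⟨0, by simp⟩
    | succ k ih =>
      obtain ⟨d, h1, h2, h3⟩ := ih
      refine ⟨(toCH z ^ k).re + d * z 0, ?_, ?_, ?_⟩ <;>
      · rw [pow_succ]
        simp only [QuaternionAlgebra.imI_mul, QuaternionAlgebra.imJ_mul,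
          QuaternionAlgebra.imK_mul, h1, h2, h3]
        simp only [toCH]
        ring
  obtain ⟨d, h1, h2, h3⟩ := key
  refine ⟨d, fun i hi => ?_⟩
  fin_cases i
  · exact absurd rfl hi
  · exact h1
  · exact h2
  · exact h3

/-- The vector part of `σ_k z` is `d` times that of `z`. Since `a ≠ b` it is also a nonzero multiple
of `s`, so `d ≠ 0` and `z` lies in the plane of `s`. -/
theorem exists_frame_of_sigma_eq {k : ℕ} {z : C4} {s : ImUnit} {a b : ℂ} (hab : a ≠ b)
    (h : sigma k z = frame s a b) : ∃ a' b', z = frame s a' b' ∧ a' ^ k = a ∧ b' ^ k = b := by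
  obtain ⟨d, hd⟩ := exists_sigma_eq_mul k z
  have hβ : (a - b) / (2 * Complex.I) ≠ 0 := div_ne_zero (sub_ne_zero.2 hab) (by simp)
  set β := (a - b) / (2 * Complex.I) with hβdef
  have hd' : ∀ i ≠ 0, d * z i = β * s.1 i := fun i hi => by
    rw [← hd i hi, h, frame_of_ne_zero _ _ _ hi]
  have hd0 : d ≠ 0 := by
    rintro rfl
    have hs : ∀ i ≠ 0, s.1 i = 0 := fun i hi => by
      simpa [hβ] using (hd' i hi).symm
    have h1 := sq_sum_imUnit s
    rw [hs 1 (by decide), hs 2 (by decide), hs 3 (by decide)] at h1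
    norm_num at h1
  have hz : z = rho ((z 0, β / d), s) := by
    ext i
    by_cases hi : i = 0
    · rw [hi, rho_zero]
    · rw [rho_of_ne_zero _ _ hi]
      have := hd' i hi
      field_simp
      linear_combination this
  rw [rho_eq_frame] at hz
  refine ⟨_, _, hz, ?_⟩
  rw [hz, sigma_frame] at h
  exact frame_inj.1 h

theorem vecSq_frame (s : ImUnit) (a b : ℂ) :
    vecSq (frame s a b) = ((a - b) / (2 * Complex.I)) ^ 2 :=
  vecSq_rho _ s

theorem norm_sq_frame (s : ImUnit) (a b : ℂ) :
    frame s a b 0 ^ 2 + vecSq (frame s a b) = a * b := by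
  rw [frame_zero, vecSq_frame, div_pow _ (2 * Complex.I), mul_pow, Complex.I_sq]
  ring

theorem rho_A (η : ℂ) (u : ℂ × ℂ) (s : ImUnit) :
    rho (A η (u, s)) =
      frame s (η * (u.1 + Complex.I * u.2)) (conj η * (u.1 - Complex.I * u.2)) := by
  simp only [A, rho_eq_frame, frame_inj]
  have h1 : η = η.re + η.im * Complex.I := (Complex.re_add_im η).symm
  have h2 : conj η = η.re - η.im * Complex.I := by
    apply Complex.ext <;> simp
  have hI := Complex.I_sq
  constructor
  · conv_rhs => rw [h1]
    linear_combination -(η.im * u.2) * hI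
  · rw [h2]
    linear_combination -(η.im * u.2) * hI

theorem rho_frakS (k : ℕ) (w : (ℂ × ℂ) × ImUnit) : rho (frakS k w) = sigma k (rho w) := by
  obtain ⟨⟨x, y⟩, s⟩ := w
  rw [rho_eq_frame (x, y), sigma_frame, frakS, rho_eq_frame, frame_inj]
  have h1 := p_spec Complex.I Complex.I_sq k x y
  have h2 := p_spec (-Complex.I) (by simp) k x y
  constructor
  · rw [h1]; ring
  · rw [sub_eq_add_neg x, ← neg_mul, h2]; ring

/-- Globally `ρ` identifies `((u₀, u₁), s)` with `((u₀, -u₁), -s)`; fixing `s` removes this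
ambiguity. -/
theorem rho_injective_of_snd_eq {w w' : (ℂ × ℂ) × ImUnit} (hs : w.2 = w'.2)
    (h : rho w = rho w') : w = w' := by
  obtain ⟨u, s⟩ := w
  obtain ⟨u', s'⟩ := w'
  obtain rfl : s = s' := hs
  have h0 := congrFun h 0
  rw [rho_zero, rho_zero] at h0
  have h1 := congrArg (dot s) h
  rw [dot_rho, dot_rho] at h1
  rw [Prod.ext h0 h1]

/-! ### Deck transformations -/

theorem conj_eq_inv_of_pow_eq_one {k : ℕ} (hk : k ≠ 0) {η : ℂ} (hη : η ^ k = 1) :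
    conj η = η⁻¹ := by
  rw [Complex.inv_def, Complex.normSq_eq_norm_sq, Complex.norm_eq_one_of_pow_eq_one hη hk]
  simp

theorem conj_pow_eq_one {k : ℕ} {η : ℂ} (hη : η ^ k = 1) : conj η ^ k = 1 := by
  rw [← map_pow, hη, map_one]

theorem frakS_A {k : ℕ} {η : ℂ} (hη : η ^ k = 1) (w : (ℂ × ℂ) × ImUnit) :
    frakS k (A η w) = frakS k w := by
  obtain ⟨u, s⟩ := w
  refine rho_injective_of_snd_eq rfl ?_
  rw [rho_frakS, rho_frakS, rho_A, rho_eq_frame, sigma_frame, sigma_frame, mul_pow, mul_pow, hη,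
    conj_pow_eq_one hη, one_mul, one_mul]

theorem A_A (η ζ : ℂ) (w : (ℂ × ℂ) × ImUnit) : A η (A ζ w) = A (η * ζ) w := by
  simp only [A, Complex.mul_re, Complex.mul_im, Complex.ofReal_sub, Complex.ofReal_add,
    Complex.ofReal_mul]
  congr 2 <;> ring

theorem A_one (w : (ℂ × ℂ) × ImUnit) : A 1 w = w := by
  simp [A]

theorem continuous_A (η : ℂ) : Continuous (A η) := by
  unfold A
  fun_prop

theorem A_mem_WK {k : ℕ} {η : ℂ} (hη : η ^ k = 1) {w : (ℂ × ℂ) × ImUnit} (hw : w ∈ WK k) :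
    A η w ∈ WK k := by
  rw [WK, Set.mem_preimage, frakS_A hη]
  exact hw

/-- `A_η` as a deck transformation of `𝔰_k : W_k → W`. -/
def deck {k : ℕ} (hk : k ≠ 0) {η : ℂ} (hη : η ^ k = 1) : WK k ≃ₜ WK k where
  toFun w := ⟨A η w, A_mem_WK hη w.2⟩
  invFun w := ⟨A (conj η) w, A_mem_WK (conj_pow_eq_one hη) w.2⟩
  left_inv w := by
    have h0 : η ≠ 0 := by rintro rfl; simp [hk] at hη
    ext1
    simp only [A_A, conj_eq_inv_of_pow_eq_one hk hη, inv_mul_cancel₀ h0, A_one]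
  right_inv w := by
    have h0 : η ≠ 0 := by rintro rfl; simp [hk] at hη
    ext1
    simp only [A_A, conj_eq_inv_of_pow_eq_one hk hη, mul_inv_cancel₀ h0, A_one]
  continuous_toFun := ((continuous_A η).comp continuous_subtype_val).subtype_mk _
  continuous_invFun := ((continuous_A _).comp continuous_subtype_val).subtype_mk _

/-- Read contrapositively: lifts of a function into `Ω` have nonzero `vecSq`, so they lift through
`ρ`. -/
theorem vecSq_sigma_eq_zero {k : ℕ} {z : C4} (h : vecSq z = 0) : vecSq (sigma k z) = 0 := by
  obtain ⟨d, hd⟩ := exists_sigma_eq_mul k z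
  rw [vecSq, hd 1 (by decide), hd 2 (by decide), hd 3 (by decide)]
  rw [vecSq] at h
  linear_combination d ^ 2 * h

/-- Conjugation sends `√-1` to `-√-1`, which exchanges the idempotents `(e₀ ∓ √-1 s) / 2`. -/
theorem conj_frame {s s' : ImUnit} (hs : ∀ i, conj (s'.1 i) = s.1 i) (a b : ℂ) (i : Fin 4) :
    conj (frame s' a b i) = frame s (conj b) (conj a) i := by
  by_cases hi : i = 0
  · rw [hi, frame_zero, frame_zero, map_div₀, map_add, map_ofNat, add_comm]
  · rw [frame_of_ne_zero _ _ _ hi, frame_of_ne_zero _ _ _ hi, map_mul, hs, map_div₀, map_mul,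
      Complex.conj_I, map_sub, map_ofNat, mul_neg, div_neg, ← neg_div, neg_sub]

theorem continuous_rho : Continuous rho := by
  unfold rho
  fun_prop

theorem continuous_frame {X : Type*} [TopologicalSpace X] {s : X → ImUnit} {a b : X → ℂ}
    (hs : Continuous s) (ha : Continuous a) (hb : Continuous b) :
    Continuous fun x => frame (s x) (a x) (b x) := by
  refine continuous_rho.comp ?_
  fun_prop

theorem continuous_dot {X : Type*} [TopologicalSpace X] {s : X → ImUnit} {G : X → C4}
    (hs : Continuous s) (hG : Continuous G) : Continuous fun x => dot (s x) (G x) := by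
  have hs' (i : Fin 4) : Continuous fun x => (s x).1 i :=
    (continuous_apply i).comp (continuous_subtype_val.comp hs)
  have hG' (i : Fin 4) : Continuous fun x => G x i := (continuous_apply i).comp hG
  exact (((hG' 1).mul (hs' 1)).add ((hG' 2).mul (hs' 2))).add ((hG' 3).mul (hs' 3))

/-! ### Continuous roots -/

/-- A nonvanishing continuous function on an open set of the plane with simply connected components
has a continuous `n`-th root. -/
theorem exists_continuous_pow_eq {U : Set ℂ} (hUo : IsOpen U)
    (hUsc : ∀ z ∈ U, SimplyConnectedSpace (connectedComponentIn U z)) {f : U → ℂ}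
    (hf : Continuous f) (hf0 : ∀ z, f z ≠ 0) {n : ℕ} (hn : n ≠ 0) :
    ∃ g : U → ℂ, Continuous g ∧ ∀ z, g z ^ n = f z := by
  classical
  let f' : ℂ → ℂ := fun z => if h : z ∈ U then f ⟨z, h⟩ else 1
  have hf'U : ∀ z : U, f' z = f z := fun z => by simp [f']
  have hf' : ContinuousOn f' U := by
    rw [continuousOn_iff_continuous_domRestrict]
    convert! hf using 1
    ext z
    exact hf'U z
  -- The root is indexed by the component as a set, so that points of one component share the same
  -- choice.
  have key : ∀ C : Set ℂ, ∃ g : ℂ → ℂ, (∃ z ∈ U, C = connectedComponentIn U z) →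
      ContinuousOn g C ∧ ∀ x, g x ^ n = f' x := by
    intro C
    by_cases h : ∃ z ∈ U, C = connectedComponentIn U z
    · obtain ⟨z, hz, rfl⟩ := h
      obtain ⟨g, hg, hgn⟩ := Complex.exists_continuousOn_pow_eq (hUsc z hz)
        hUo.connectedComponentIn (hf'.mono (connectedComponentIn_subset U z))
        (by
          rintro ⟨w, hw, hw0⟩
          have hwU := connectedComponentIn_subset U z hw
          exact hf0 ⟨w, hwU⟩ ((hf'U ⟨w, hwU⟩).symm.trans hw0)) hn
      exact ⟨g, fun _ => ⟨hg, hgn⟩⟩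
    · exact ⟨0, fun h' => absurd h' h⟩
  choose g hg using key
  refine ⟨fun z => g (connectedComponentIn U z) z, ?_, fun z => ?_⟩
  · rw [continuous_iff_continuousAt]
    intro z
    have hopen : connectedComponentIn U (z : ℂ) ∈ nhds (z : ℂ) :=
      hUo.connectedComponentIn.mem_nhds (mem_connectedComponentIn z.2)
    have hc : ContinuousAt (fun w : U => g (connectedComponentIn U z) w) z :=
      ContinuousAt.comp (f := ((↑) : U → ℂ))
        ((hg _ ⟨z, z.2, rfl⟩).1.continuousAt hopen) continuousAt_subtype_val
    refine hc.congr ?_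
    filter_upwards [continuousAt_subtype_val.preimage_mem_nhds hopen] with w hw
    rw [connectedComponentIn_eq hw]
  · rw [(hg _ ⟨z, z.2, rfl⟩).2, hf'U]

theorem conj_eq_self_of_sq_eq {γ : ℂ} {r : ℝ} (hr : 0 ≤ r) (h : γ ^ 2 = r) : conj γ = γ := by
  have h' : γ ^ 2 = (Real.sqrt r : ℂ) ^ 2 := by
    rw [h, ← Complex.ofReal_pow, Real.sq_sqrt hr]
  rcases sq_eq_sq_iff_eq_or_eq_neg.1 h' with h | h <;> simp [h]

/-- Complex conjugation on a symmetric set. -/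
def conjMap {U : Set ℂ} (hU : ∀ z ∈ U, conj z ∈ U) (z : U) : U :=
  ⟨conj (z : ℂ), hU z z.2⟩

/-! ### Symmetric square roots and lifts through `ρ` -/

section Symmetric

variable {U : Set ℂ} (hU : ∀ z ∈ U, conj z ∈ U)

theorem conjMap_conjMap (z : U) : conjMap hU (conjMap hU z) = z :=
  Subtype.ext (Complex.conj_conj _)

theorem continuous_conjMap : Continuous (conjMap hU) := by
  unfold conjMap
  fun_prop

theorem T_eq_self_iff {G : U → C4} :
    T hU G = G ↔ ∀ z i, conj (G (conjMap hU z) i) = G z i := by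
  simp only [funext_iff, T, conjMap]

theorem conjMap_eq_self {z : U} (hz : (z : ℂ).im = 0) : conjMap hU z = z :=
  Subtype.ext (Complex.conj_eq_iff_im.2 hz)

/-- The imaginary parts of points of `U` form an interval symmetric about `0`. -/
theorem exists_conjMap_eq_self (h : IsConnected U) : ∃ x : U, conjMap hU x = x := by
  obtain ⟨z, hz⟩ := h.nonempty
  have hI := h.isPreconnected.image Complex.im Complex.continuous_im.continuousOn
  have h1 : z.im ∈ Complex.im '' U := ⟨z, hz, rfl⟩
  have h2 : -z.im ∈ Complex.im '' U := ⟨conj z, hU z hz, Complex.conj_im z⟩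
  have h0 : (0 : ℝ) ∈ Complex.im '' U := by
    rcases le_total z.im 0 with h | h
    · exact hI.ordConnected.out h1 h2 ⟨h, by linarith⟩
    · exact hI.ordConnected.out h2 h1 ⟨by linarith, h⟩
  obtain ⟨x, hx, hx0⟩ := h0
  exact ⟨⟨x, hx⟩, conjMap_eq_self hU hx0⟩

/-- A symmetric nonvanishing function that is nonnegative on the real axis has a symmetric
square root. -/
theorem exists_symmetric_sqrt (hUo : IsOpen U)
    (hUsc : ∀ z ∈ U, SimplyConnectedSpace (connectedComponentIn U z)) {f : U → ℂ}
    (hf : Continuous f) (hf0 : ∀ z, f z ≠ 0) (hfT : ∀ z, conj (f (conjMap hU z)) = f z)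
    (hreal : ∀ z, conjMap hU z = z → ∃ r : ℝ, 0 ≤ r ∧ f z = r) :
    ∃ g : U → ℂ, Continuous g ∧ (∀ z, g z ^ 2 = f z) ∧
      ∀ z, conj (g (conjMap hU z)) = g z := by
  obtain ⟨g, hg, hgf⟩ := exists_continuous_pow_eq hUo hUsc hf hf0 two_ne_zero
  have hgreal : ∀ z : U, (z : ℂ).im = 0 → conj (g (conjMap hU z)) = g z := by
    intro z hz
    have hz' := conjMap_eq_self hU hz
    obtain ⟨r, hr, hfr⟩ := hreal z hz'
    rw [hz']
    exact conj_eq_self_of_sq_eq hr ((hgf z).trans hfr)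
  have him : ∀ z : U, ((conjMap hU z : U) : ℂ).im = -(z : ℂ).im := fun z => Complex.conj_im _
  -- Keep the root on the closed upper half and reflect it below. The halves agree on the real axis,
  -- where a square root of a nonnegative real is real.
  refine ⟨fun z => if 0 ≤ (z : ℂ).im then g z else conj (g (conjMap hU z)), ?_, ?_, ?_⟩
  · refine Continuous.if_le hg (Complex.continuous_conj.comp (hg.comp (continuous_conjMap hU)))
      continuous_const (Complex.continuous_im.comp continuous_subtype_val) ?_
    intro z hz
    exact (hgreal z hz.symm).symm
  · intro z
    dsimp only
    split_ifs
    · exact hgf z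
    · rw [← map_pow, hgf, hfT]
  · intro z
    dsimp only
    rcases lt_trichotomy (z : ℂ).im 0 with h | h | h
    · rw [if_pos (by rw [him]; linarith), if_neg (by linarith)]
    · rw [if_pos (by rw [him]; linarith), if_pos (by linarith), hgreal z h]
    · rw [if_neg (by rw [him]; linarith), if_pos (by linarith), conjMap_conjMap,
        Complex.conj_conj]

theorem vecSq_nonneg_of_conj_eq {z : C4} (h : ∀ i, conj (z i) = z i) :
    ∃ r : ℝ, 0 ≤ r ∧ vecSq z = r := by
  refine ⟨(z 1).re ^ 2 + (z 2).re ^ 2 + (z 3).re ^ 2, by positivity, ?_⟩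
  rw [vecSq, ← Complex.conj_eq_iff_re.1 (h 1), ← Complex.conj_eq_iff_re.1 (h 2),
    ← Complex.conj_eq_iff_re.1 (h 3)]
  simp

theorem vecSq_symmetric {G : U → C4} (hGT : T hU G = G) (z : U) :
    conj (vecSq (G (conjMap hU z))) = vecSq (G z) := by
  have h := (T_eq_self_iff hU).1 hGT z
  simp only [vecSq, map_add, map_pow, h]

theorem vecSq_nonneg_of_conjMap_eq {G : U → C4} (hGT : T hU G = G) {z : U}
    (hz : conjMap hU z = z) : ∃ r : ℝ, 0 ≤ r ∧ vecSq (G z) = r := by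
  refine vecSq_nonneg_of_conj_eq fun i => ?_
  have h := (T_eq_self_iff hU).1 hGT z i
  rwa [hz] at h

/-- A stem function with nonvanishing `vecSq` lifts through `ρ`, symmetrically. -/
theorem exists_rho_lift (hUo : IsOpen U)
    (hUsc : ∀ z ∈ U, SimplyConnectedSpace (connectedComponentIn U z)) {G : U → C4}
    (hG : Continuous G) (hGT : T hU G = G) (hG0 : ∀ z, vecSq (G z) ≠ 0) :
    ∃ H : U → (ℂ × ℂ) × ImUnit, Continuous H ∧ rho ∘ H = G ∧
      ∀ z, conj ((H (conjMap hU z)).1.2) = (H z).1.2 := by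
  have hcont : Continuous fun z => vecSq (G z) := by
    unfold vecSq
    fun_prop
  obtain ⟨g, hg, hgG, hgT⟩ := exists_symmetric_sqrt hU hUo hUsc hcont hG0
    (vecSq_symmetric hU hGT) fun z hz => vecSq_nonneg_of_conjMap_eq hU hGT hz
  have hg0 : ∀ z, g z ≠ 0 := fun z h => hG0 z (by rw [← hgG, h]; ring)
  have hs : ∀ z, vecSq (![0, G z 1 / g z, G z 2 / g z, G z 3 / g z] : C4) = 1 := fun z => by
    have h := hgG z
    have h0 := hg0 z
    simp only [vecSq] at h ⊢
    simp only [Matrix.cons_val]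
    field_simp
    exact h.symm
  -- Dividing the vector part by a square root `g` of `vecSq ∘ G` normalizes it to an imaginary
  -- unit.
  refine ⟨fun z => ((G z 0, g z), ⟨![0, G z 1 / g z, G z 2 / g z, G z 3 / g z], rfl, hs z⟩),
    ?_, ?_, hgT⟩
  · refine Continuous.prodMk (by fun_prop) (Continuous.subtype_mk ?_ _)
    refine continuous_pi fun i => ?_
    have hdiv : ∀ j, Continuous fun z => G z j / g z := fun j =>
      Continuous.div (by fun_prop) hg hg0
    fin_cases i
    · exact continuous_const
    · exact hdiv 1
    · exact hdiv 2
    · exact hdiv 3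
  · ext z i
    rw [Function.comp_apply]
    by_cases hi : i = 0
    · rw [hi, rho_zero]
    · rw [rho_of_ne_zero _ _ hi]
      have h0 := hg0 z
      fin_cases i
      · exact absurd rfl hi
      all_goals exact mul_div_cancel₀ _ h0

end Symmetric

/-! ### Lifts in adapted coordinates -/

theorem card_rootsU {k : ℕ} (hk : k ≠ 0) : (rootsU k).Finite ∧ (rootsU k).ncard = k := by
  have h : rootsU k = (Polynomial.nthRootsFinset k (1 : ℂ) : Set ℂ) := by
    ext η
    rw [Finset.mem_coe, Polynomial.mem_nthRootsFinset (Nat.pos_of_ne_zero hk)]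
    rfl
  rw [h]
  refine ⟨Finset.finite_toSet _, ?_⟩
  rw [Set.ncard_coe_finset, (Complex.isPrimitiveRoot_exp k hk).card_nthRootsFinset]

/-- On a connected space, two continuous `k`-th roots of a nonvanishing function differ by a
constant root of unity. -/
theorem exists_root_mul_eq {X : Type*} [TopologicalSpace X] [ConnectedSpace X] {k : ℕ}
    (hk : k ≠ 0) {a a' : X → ℂ} (ha : Continuous a) (ha' : Continuous a') (ha0 : ∀ x, a x ≠ 0)
    (h : ∀ x, a' x ^ k = a x ^ k) : ∃ η ∈ rootsU k, ∀ x, a' x = η * a x := by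
  obtain ⟨x₀⟩ : Nonempty X := inferInstance
  have hmaps : Set.MapsTo (fun x => a' x / a x) Set.univ (rootsU k) := fun x _ => by
    change (a' x / a x) ^ k = 1
    rw [div_pow, h, div_self (pow_ne_zero k (ha0 x))]
  refine ⟨a' x₀ / a x₀, hmaps (Set.mem_univ x₀), fun x => ?_⟩
  have hconst : a' x / a x = a' x₀ / a x₀ :=
    isPreconnected_univ.constant_of_mapsTo (card_rootsU hk).1.isDiscrete
      (ha'.div ha ha0).continuousOn hmaps (Set.mem_univ x) (Set.mem_univ x₀)
  rw [← hconst, div_mul_cancel₀ _ (ha0 x)]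

section Frame

variable {k : ℕ} {U : Set ℂ} {F : U → C4} {s : U → ImUnit} {a b : U → ℂ}

theorem frame_mem_lifts (hs : Continuous s) (ha : Continuous a) (hb : Continuous b)
    (hF : ∀ z, F z = frame (s z) (a z ^ k) (b z ^ k)) {η ζ : ℂ} (hη : η ∈ rootsU k)
    (hζ : ζ ∈ rootsU k) : (fun z => frame (s z) (η * a z) (ζ * b z)) ∈ lifts k F := by
  refine ⟨continuous_frame hs (continuous_const.mul ha) (continuous_const.mul hb), fun z => ?_⟩
  have hη' : η ^ k = 1 := hη
  have hζ' : ζ ^ k = 1 := hζ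
  rw [sigma_frame, mul_pow, mul_pow, hη', hζ', one_mul, one_mul, hF]

theorem frame_mul_inj [Nonempty U] (ha0 : ∀ z, a z ≠ 0) (hb0 : ∀ z, b z ≠ 0) {η ζ η' ζ' : ℂ}
    (h : (fun z => frame (s z) (η * a z) (ζ * b z)) =
      fun z => frame (s z) (η' * a z) (ζ' * b z)) : η = η' ∧ ζ = ζ' := by
  obtain ⟨z⟩ : Nonempty U := inferInstance
  obtain ⟨h1, h2⟩ := frame_inj.1 (congrFun h z)
  exact ⟨mul_right_cancel₀ (ha0 z) h1, mul_right_cancel₀ (hb0 z) h2⟩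

/-- The pointwise coordinates of `G` are `G z 0 ± √-1 dot (s z) (G z)`, hence continuous, and so
differ from `a` and `b` by constant roots of unity. -/
theorem exists_eq_frame_mul [ConnectedSpace U] (hk : k ≠ 0) (hs : Continuous s)
    (ha : Continuous a) (hb : Continuous b) (ha0 : ∀ z, a z ≠ 0) (hb0 : ∀ z, b z ≠ 0)
    (hab : ∀ z, a z ^ k ≠ b z ^ k) (hF : ∀ z, F z = frame (s z) (a z ^ k) (b z ^ k))
    {G : U → C4} (hG : G ∈ lifts k F) :
    ∃ η ∈ rootsU k, ∃ ζ ∈ rootsU k, G = fun z => frame (s z) (η * a z) (ζ * b z) := by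
  choose a' b' hG' ha' hb' using fun z =>
    exists_frame_of_sigma_eq (hab z) ((hG.2 z).trans (hF z))
  have h0 : Continuous fun z => G z 0 := (continuous_apply 0).comp hG.1
  have hd := continuous_dot hs hG.1
  have hca : Continuous a' := by
    have h : Continuous fun z => G z 0 + Complex.I * dot (s z) (G z) :=
      h0.add (continuous_const.mul hd)
    refine h.congr fun z => ?_
    rw [hG' z, frame_fst]
  have hcb : Continuous b' := by
    have h : Continuous fun z => G z 0 - Complex.I * dot (s z) (G z) :=
      h0.sub (continuous_const.mul hd)
    refine h.congr fun z => ?_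
    rw [hG' z, frame_snd]
  obtain ⟨η, hη, h1⟩ := exists_root_mul_eq hk ha hca ha0 ha'
  obtain ⟨ζ, hζ, h2⟩ := exists_root_mul_eq hk hb hcb hb0 hb'
  exact ⟨η, hη, ζ, hζ, funext fun z => by rw [hG' z, h1, h2]⟩

theorem ncard_lifts [ConnectedSpace U] (hk : k ≠ 0) (hs : Continuous s)
    (ha : Continuous a) (hb : Continuous b) (ha0 : ∀ z, a z ≠ 0) (hb0 : ∀ z, b z ≠ 0)
    (hab : ∀ z, a z ^ k ≠ b z ^ k) (hF : ∀ z, F z = frame (s z) (a z ^ k) (b z ^ k)) :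
    (lifts k F).ncard = k ^ 2 := by
  have himage : lifts k F = (fun p : ℂ × ℂ => fun z => frame (s z) (p.1 * a z) (p.2 * b z)) ''
      (rootsU k ×ˢ rootsU k) := by
    ext G
    constructor
    · intro hG
      obtain ⟨η, hη, ζ, hζ, rfl⟩ := exists_eq_frame_mul hk hs ha hb ha0 hb0 hab hF hG
      exact ⟨(η, ζ), ⟨hη, hζ⟩, rfl⟩
    · rintro ⟨p, hp, rfl⟩
      exact frame_mem_lifts hs ha hb hF hp.1 hp.2
  rw [himage, Set.ncard_image_of_injective, Set.ncard_prod, (card_rootsU hk).2, pow_two]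
  intro p q h
  exact Prod.ext_iff.2 (frame_mul_inj ha0 hb0 h)

variable (hU : ∀ z ∈ U, conj z ∈ U)

/-- The condition on the other coordinate is the same equation, conjugated and evaluated at `conj
z`. -/
theorem T_frame_eq_self_iff (hsT : ∀ z i, conj ((s (conjMap hU z)).1 i) = (s z).1 i) :
    T hU (fun z => frame (s z) (a z) (b z)) = (fun z => frame (s z) (a z) (b z)) ↔
      ∀ z, conj (b (conjMap hU z)) = a z := by
  rw [T_eq_self_iff]
  simp only [fun z => conj_frame (hsT z)]
  constructor
  · exact fun h z => (frame_inj.1 (funext (h z))).1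
  · intro h z i
    have h' : conj (a (conjMap hU z)) = b z := by
      rw [← h, conjMap_conjMap, Complex.conj_conj]
    rw [h, h']

end Frame

/-! ### Stem lifts and their orbits under `A_η` -/

section Orbit

variable {k : ℕ} {U : Set ℂ} (hU : ∀ z ∈ U, conj z ∈ U) {F G : U → C4}
  {H : U → (ℂ × ℂ) × ImUnit}

/-- Membership in `Ω` enters through `a ^ k * b ^ k = z₀ ^ 2 + vecSq z`, which keeps `a` and `b`
from vanishing, and through `vecSq z ≠ 0`, which separates `a ^ k` from `b ^ k`. -/
theorem frame_of_rho_lift (hk : k ≠ 0) (hFΩ : ∀ z, F z ∈ Omega) (hG : G ∈ lifts k F)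
    (hH : Continuous H) (hHG : rho ∘ H = G) :
    ∃ (s : U → ImUnit) (a b : U → ℂ), Continuous s ∧ Continuous a ∧ Continuous b ∧
      (∀ z, a z ≠ 0) ∧ (∀ z, b z ≠ 0) ∧ (∀ z, a z ^ k ≠ b z ^ k) ∧
      (∀ z, F z = frame (s z) (a z ^ k) (b z ^ k)) ∧ (∀ z, s z = (H z).2) ∧
      ∀ η, rho ∘ A η ∘ H = fun z => frame (s z) (η * a z) (conj η * b z) := by
  refine ⟨fun z => (H z).2, fun z => (H z).1.1 + Complex.I * (H z).1.2,
    fun z => (H z).1.1 - Complex.I * (H z).1.2, by fun_prop, by fun_prop, by fun_prop, ?_⟩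
  have hF : ∀ z, F z = frame (H z).2 (((H z).1.1 + Complex.I * (H z).1.2) ^ k)
      (((H z).1.1 - Complex.I * (H z).1.2) ^ k) := fun z => by
    rw [← hG.2 z, ← hHG, ← sigma_frame, ← rho_eq_frame, Function.comp_apply]
  have hprod : ∀ z, ((H z).1.1 + Complex.I * (H z).1.2) ^ k *
      ((H z).1.1 - Complex.I * (H z).1.2) ^ k ≠ 0 := fun z => by
    rw [← norm_sq_frame (H z).2, ← hF]
    exact (hFΩ z).2.1
  refine ⟨fun z h => hprod z ?_, fun z h => hprod z ?_, fun z h => (hFΩ z).1 ?_, hF,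
    fun _ => rfl, fun η => funext fun z => rho_A η (H z).1 (H z).2⟩
  · dsimp only at h
    rw [h, zero_pow hk, zero_mul]
  · dsimp only at h
    rw [h, zero_pow hk, mul_zero]
  · rw [hF, vecSq_frame, h]
    simp

theorem snd_ne_zero_of_mem_lifts (hFΩ : ∀ z, F z ∈ Omega) (hG : G ∈ lifts k F)
    (hHG : rho ∘ H = G) (z : U) : (H z).1.2 ≠ 0 := by
  intro h
  refine (hFΩ z).1 ?_
  rw [← hG.2 z]
  refine vecSq_sigma_eq_zero ?_
  rw [← hHG]
  change vecSq (rho ((H z).1, (H z).2)) = 0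
  rw [vecSq_rho, h]
  ring

theorem imUnit_symmetric (hGT : T hU G = G) (hHG : rho ∘ H = G) (h0 : ∀ z, (H z).1.2 ≠ 0)
    (hHT : ∀ z, conj ((H (conjMap hU z)).1.2) = (H z).1.2) (z : U) (i : Fin 4) :
    conj ((H (conjMap hU z)).2.1 i) = (H z).2.1 i := by
  by_cases hi : i = 0
  · rw [hi, (H z).2.2.1, (H (conjMap hU z)).2.2.1, map_zero]
  · have h := (T_eq_self_iff hU).1 hGT z i
    rw [← hHG, Function.comp_apply, Function.comp_apply] at h
    change conj (rho ((H (conjMap hU z)).1, (H (conjMap hU z)).2) i) =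
      rho ((H z).1, (H z).2) i at h
    rw [rho_of_ne_zero _ _ hi, rho_of_ne_zero _ _ hi, map_mul, hHT] at h
    exact mul_left_cancel₀ (h0 z) h

/-- The orbit of a stem lift under the deck transformations `A_η`. -/
theorem stemLifts_orbit [Nonempty U] (hk : k ≠ 0) (hFΩ : ∀ z, F z ∈ Omega)
    (hG : G ∈ stemLifts k hU F) (hH : Continuous H) (hHG : rho ∘ H = G)
    (hHT : ∀ z, conj ((H (conjMap hU z)).1.2) = (H z).1.2) :
    Set.MapsTo (fun η => rho ∘ A η ∘ H) (rootsU k) (stemLifts k hU F) ∧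
    Set.InjOn (fun η => rho ∘ A η ∘ H) (rootsU k) ∧
    (ConnectedSpace U →
      Set.SurjOn (fun η => rho ∘ A η ∘ H) (rootsU k) (stemLifts k hU F)) := by
  obtain ⟨s, a, b, hs, ha, hb, ha0, hb0, hab, hF, hsH, hA⟩ :=
    frame_of_rho_lift hk hFΩ hG.1 hH hHG
  have hsT : ∀ z i, conj ((s (conjMap hU z)).1 i) = (s z).1 i := fun z i => by
    rw [hsH, hsH]
    exact imUnit_symmetric hU hG.2 hHG (snd_ne_zero_of_mem_lifts hFΩ hG.1 hHG) hHT z i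
  have hGframe : G = fun z => frame (s z) (a z) (b z) := by
    have h := hA 1
    simp only [map_one, one_mul] at h
    rw [← h, ← hHG]
    exact funext fun z => by simp only [Function.comp_apply, A_one]
  have hbT : ∀ z, conj (b (conjMap hU z)) = a z := by
    rw [← T_frame_eq_self_iff hU hsT, ← hGframe]
    exact hG.2
  refine ⟨fun η hη => ?_, fun η _ η' _ h => ?_, fun _ G' hG' => ?_⟩
  · dsimp only
    rw [hA]
    refine ⟨frame_mem_lifts hs ha hb hF hη (conj_pow_eq_one hη), ?_⟩
    rw [T_frame_eq_self_iff hU hsT]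
    intro z
    rw [map_mul, Complex.conj_conj, hbT]
  · dsimp only at h
    rw [hA, hA] at h
    exact (frame_mul_inj ha0 hb0 h).1
  · obtain ⟨η, hη, ζ, -, rfl⟩ := exists_eq_frame_mul hk hs ha hb ha0 hb0 hab hF hG'.1
    refine ⟨η, hη, ?_⟩
    obtain ⟨z⟩ : Nonempty U := inferInstance
    -- A single point suffices to read off `conj ζ = η`, as both are constants.
    have h := (T_frame_eq_self_iff hU hsT).1 hG'.2 z
    rw [map_mul, hbT] at h
    have h' := mul_right_cancel₀ (ha0 z) h
    dsimp only
    rw [hA, ← h', Complex.conj_conj]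

/-- On a connected symmetric set, every lift through `ρ` of a stem function is symmetric. -/
theorem rho_lift_symmetric (hUc : IsConnected U) (hGT : T hU G = G) (hH : Continuous H)
    (hHG : rho ∘ H = G) (h0 : ∀ z, (H z).1.2 ≠ 0) (z : U) :
    conj ((H (conjMap hU z)).1.2) = (H z).1.2 := by
  have : ConnectedSpace U := isConnected_iff_connectedSpace.1 hUc
  have hsq : ∀ z, vecSq (G z) = (H z).1.2 ^ 2 := fun z => by
    rw [← hHG]
    exact vecSq_rho (H z).1 (H z).2
  obtain ⟨x, hx⟩ := exists_conjMap_eq_self hU hUc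
  obtain ⟨r, hr, hxr⟩ := vecSq_nonneg_of_conjMap_eq hU hGT hx
  have hcm := continuous_conjMap hU
  -- Both sides are continuous square roots of the nonvanishing `vecSq ∘ G`, and they agree at the
  -- real point `x`.
  refine isPreconnected_univ.eq_of_sq_eq (f := fun z => conj ((H (conjMap hU z)).1.2))
    (g := fun z => (H z).1.2) (y := x)
    (Complex.continuous_conj.comp (by fun_prop)).continuousOn
    (by fun_prop) (fun z _ => ?_) (fun {z} _ => h0 z) (Set.mem_univ x) ?_ (Set.mem_univ z)
  · simp only [Pi.pow_apply]
    rw [← map_pow, ← hsq, ← hsq, vecSq_symmetric hU hGT]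
  · rw [hx]
    exact conj_eq_self_of_sq_eq hr ((hsq x).symm.trans hxr)

theorem stemLifts_nonempty (hk : k ≠ 0) (hUo : IsOpen U)
    (hUsc : ∀ z ∈ U, SimplyConnectedSpace (connectedComponentIn U z)) (hFc : Continuous F)
    (hFT : T hU F = F) (hFΩ : ∀ z, F z ∈ Omega) : (stemLifts k hU F).Nonempty := by
  obtain ⟨H, hH, hHF, hHT⟩ := exists_rho_lift hU hUo hUsc hFc hFT fun z => (hFΩ z).1
  -- As a lift of itself through `σ_1`, `F` gets its own coordinates `c`, `d` from
  -- `frame_of_rho_lift`.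
  have hF1 : F ∈ lifts 1 F := ⟨hFc, fun z => by rw [sigma, pow_one, ofCH_toCH]⟩
  obtain ⟨s, c, d, hs, hc, hd, hc0, hd0, -, hF, hsH, -⟩ :=
    frame_of_rho_lift one_ne_zero hFΩ hF1 hH hHF
  simp only [pow_one] at hF
  have hsT : ∀ z i, conj ((s (conjMap hU z)).1 i) = (s z).1 i := fun z i => by
    rw [hsH, hsH]
    exact imUnit_symmetric hU hFT hHF (snd_ne_zero_of_mem_lifts hFΩ hF1 hHF) hHT z i
  have hdT : ∀ z, conj (d (conjMap hU z)) = c z := by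
    rw [← T_frame_eq_self_iff hU hsT, ← funext hF]
    exact hFT
  obtain ⟨a, ha, hac⟩ := exists_continuous_pow_eq hUo hUsc hc hc0 hk
  -- Only `c` needs a chosen root: since `d` is the reflection of `c`, the reflection of `a` is a
  -- root of `d`.
  refine ⟨fun z => frame (s z) (a z) (conj (a (conjMap hU z))), ⟨?_, fun z => ?_⟩, ?_⟩
  · exact continuous_frame hs ha
      (Complex.continuous_conj.comp (ha.comp (continuous_conjMap hU)))
  · rw [sigma_frame, ← map_pow, hac, hac, hF, ← hdT (conjMap hU z), conjMap_conjMap,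
      Complex.conj_conj]
  · rw [T_frame_eq_self_iff hU hsT]
    intro z
    rw [conjMap_conjMap, Complex.conj_conj]

end Orbit

end SliceRoots

end

open SliceRoots in
theorem mainTheorem9 (k : ℕ) (hk : Odd k)
    (U : Set ℂ) (hUo : IsOpen U) (hUne : U.Nonempty)
    (hU : ∀ z ∈ U, conj z ∈ U)
    (hUsc : ∀ z ∈ U, SimplyConnectedSpace (connectedComponentIn U z))
    (F : U → C4) (hFc : Continuous F) (hFstem : T hU F = F) (hFΩ : ∀ z, F z ∈ Omega) :
    -- the maps `A_η` are deck transformations of `𝔰_k : W_k → W`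
    (∀ η ∈ rootsU k, ∃ φ : WK k ≃ₜ WK k,
      (∀ w, (φ w : (ℂ × ℂ) × ImUnit) = A η w) ∧ ∀ w : WK k, frakS k (φ w) = frakS k w) ∧
    -- there are at least `k` stem functions among the lifts, forming an orbit of the `A_η`,
    -- whether or not `U` has real points (and so is possibly not connected)
    (stemLifts k hU F).Nonempty ∧
    (∀ G ∈ stemLifts k hU F, ∃ H : U → (ℂ × ℂ) × ImUnit, Continuous H ∧ rho ∘ H = G ∧
      Set.MapsTo (fun η => rho ∘ A η ∘ H) (rootsU k) (stemLifts k hU F) ∧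
      Set.InjOn (fun η => rho ∘ A η ∘ H) (rootsU k)) ∧
    (k : ℕ∞) ≤ (stemLifts k hU F).encard ∧
    -- if `U` is connected, there are `k ^ 2` lifts, exactly `k` of them are stem functions, and
    -- these are obtained from any one of them by the `A_η`
    (IsConnected U →
      (lifts k F).ncard = k ^ 2 ∧
      (stemLifts k hU F).ncard = k ∧
      ∀ G ∈ stemLifts k hU F,
        (∃ H : U → (ℂ × ℂ) × ImUnit, Continuous H ∧ rho ∘ H = G) ∧
        ∀ H : U → (ℂ × ℂ) × ImUnit, Continuous H → rho ∘ H = G →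
          Set.BijOn (fun η => rho ∘ A η ∘ H) (rootsU k) (stemLifts k hU F)) := by
  have hk0 : k ≠ 0 := hk.pos.ne'
  have : Nonempty U := hUne.to_subtype
  have hG0 : ∀ G ∈ lifts k F, ∀ z, vecSq (G z) ≠ 0 := fun G hG z h =>
    (hFΩ z).1 (by rw [← hG.2 z]; exact vecSq_sigma_eq_zero h)
  have hlift : ∀ G ∈ stemLifts k hU F, ∃ H : U → (ℂ × ℂ) × ImUnit, Continuous H ∧
      rho ∘ H = G ∧ ∀ z, conj ((H (conjMap hU z)).1.2) = (H z).1.2 := fun G hG =>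
    exists_rho_lift hU hUo hUsc hG.1.1 hG.2 (hG0 G hG.1)
  have hne := stemLifts_nonempty hU hk0 hUo hUsc hFc hFstem hFΩ
  obtain ⟨G₀, hG₀⟩ := hne
  obtain ⟨H₀, hH₀, hHG₀, hHT₀⟩ := hlift G₀ hG₀
  obtain ⟨hmaps, hinj, hsurj⟩ := stemLifts_orbit hU hk0 hFΩ hG₀ hH₀ hHG₀ hHT₀
  obtain ⟨hfin, hcard⟩ := card_rootsU hk0
  refine ⟨fun η hη => ⟨deck hk0 hη, fun _ => rfl, fun w => frakS_A hη w⟩, ⟨G₀, hG₀⟩, ?_, ?_, ?_⟩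
  · intro G hG
    obtain ⟨H, hH, hHG, hHT⟩ := hlift G hG
    obtain ⟨h1, h2, -⟩ := stemLifts_orbit hU hk0 hFΩ hG hH hHG hHT
    exact ⟨H, hH, hHG, h1, h2⟩
  · calc (k : ℕ∞) = (rootsU k).encard := by rw [← hfin.cast_ncard_eq, hcard]
      _ = ((fun η => rho ∘ A η ∘ H₀) '' rootsU k).encard := hinj.encard_image.symm
      _ ≤ _ := Set.encard_le_encard hmaps.image_subset
  · intro hUc
    have hconn : ConnectedSpace U := isConnected_iff_connectedSpace.1 hUc
    refine ⟨?_, ?_, fun G hG => ⟨?_, fun H hH hHG => ?_⟩⟩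
    · obtain ⟨s, a, b, hs, ha, hb, ha0, hb0, hab, hF, -, -⟩ :=
        frame_of_rho_lift hk0 hFΩ hG₀.1 hH₀ hHG₀
      exact ncard_lifts hk0 hs ha hb ha0 hb0 hab hF
    · rw [← Set.BijOn.image_eq ⟨hmaps, hinj, hsurj hconn⟩, hinj.ncard_image, hcard]
    · obtain ⟨H, hH, hHG, -⟩ := hlift G hG
      exact ⟨H, hH, hHG⟩
    -- This `H` is arbitrary; connectedness of `U` supplies the symmetry that the orbit argument
    -- needs.
    · obtain ⟨h1, h2, h3⟩ := stemLifts_orbit hU hk0 hFΩ hG hH hHG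
        (rho_lift_symmetric hU hUc hG.2 hH hHG (snd_ne_zero_of_mem_lifts hFΩ hG.1 hHG))
      exact ⟨h1, h2, h3 hconn⟩
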